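/- Theorem 4.6 (fractional Sobolev–Poincaré inequality). Let $n\ge 2$ and let $G\subset\mathbb{R}^n$ be a $1$-John domain, that is, a bounded domain (nonempty, open, connected) for which there are a point $x_0\in G$ and a constant $c_J>0$ such that every $x\in G$ can be joined to $x_0$ by a rectifiable curve $\gamma:[0,l]\to G$, parametrized by its arc length, with $\gamma(0)=x$, $\gamma(l)=x_0$, $l\le c_J$ and $$\operatorname{dist}(\gamma(t),\partial G)\ge t/c_J\qquad\text{for all } t\in[0,l].$$ Let $\tau,\delta\in(0,1)$, $p<n/\delta$ and $$1<p\le q\le \frac{np}{n-\delta p}.$$ Then $G$ supports the fractional $(q,p)$-Poincaré inequality: there is a finite constant $c$ such that for every $u\in L^p(G)$, with mean value $u_G=\frac1{|G|}\int_G u(y)\,dy$, $$\int_G|u(x)-u_G|^q\,dx\le c\left(\int_G\int_{G\cap B^n(x,\tau\operatorname{dist}(x,\partial G))}\frac{|u(x)-u(y)|^p}{|x-y|^{n+\delta p}}\,dy\,dx\right)^{q/p},$$ where the right-hand side may be infinite and $c$ does not depend on $u$. -/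

import Mathlib

open MeasureTheory Metric
open scoped NNReal ENNReal

/-- A bounded domain in `ℝⁿ`: a bounded, open, connected, nonempty set. -/
structure IsBoundedDomain {n : ℕ} (G : Set (EuclideanSpace ℝ (Fin n))) : Prop where
  isOpen : IsOpen G
  isConnected : IsConnected G
  isBounded : Bornology.IsBounded G

/-- An `s`-John domain, `s ≥ 1`: a bounded domain `G` with a point `x₀ ∈ G` and a constant `c > 0`
such that every `x ∈ G` is joined to `x₀` by a curve `γ : [0,l] → G` parametrized by arc length
(so automatically rectifiable and continuous), with `γ(0) = x`, `γ(l) = x₀`, `l ≤ c` and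
`dist(γ(t), ∂G) ≥ t^s / c` for all `t ∈ [0,l]`. Only the values of `γ` on `[0,l]` matter. -/
def IsJohnDomain {n : ℕ} (s : ℝ) (G : Set (EuclideanSpace ℝ (Fin n))) : Prop :=
  1 ≤ s ∧ IsBoundedDomain G ∧
    ∃ x₀ ∈ G, ∃ c : ℝ, 0 < c ∧ ∀ x ∈ G,
      ∃ (l : ℝ) (γ : ℝ → EuclideanSpace ℝ (Fin n)),
        0 ≤ l ∧ l ≤ c ∧
        (∀ t ∈ Set.Icc 0 l, γ t ∈ G) ∧
        HasUnitSpeedOn γ (Set.Icc 0 l) ∧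
        γ 0 = x ∧ γ l = x₀ ∧
        ∀ t ∈ Set.Icc 0 l, t ^ s / c ≤ infDist (γ t) (frontier G)

/-- The local fractional energy
`∫_G ∫_{G ∩ B(x, τ dist(x, ∂G))} |u(x) - u(y)|^p / |x - y|^(n + δp) dy dx`, a value in `[0,∞]`. -/
noncomputable def localFractionalEnergy {n : ℕ} (G : Set (EuclideanSpace ℝ (Fin n)))
    (p δ τ : ℝ) (u : EuclideanSpace ℝ (Fin n) → ℝ) : ℝ≥0∞ :=
  ∫⁻ x in G, ∫⁻ y in G ∩ ball x (τ * infDist x (frontier G)),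
    ‖u x - u y‖ₑ ^ p / ‖x - y‖ₑ ^ ((n : ℝ) + δ * p)

/-- `G` supports the fractional `(q,p)`-Poincaré inequality with parameters `δ` and `τ`: there is a
finite constant `c` with `∫_G |u - u_G|^q ≤ c * (localFractionalEnergy G p δ τ u)^(q/p)` for all
`u ∈ L^p(G)`, where `u_G` is the mean value of `u` over `G`. -/
def SupportsFractionalPoincare {n : ℕ} (G : Set (EuclideanSpace ℝ (Fin n)))
    (q p δ τ : ℝ) : Prop :=
  ∃ c : ℝ≥0, ∀ u : EuclideanSpace ℝ (Fin n) → ℝ,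
    MemLp u (ENNReal.ofReal p) (volume.restrict G) →
      ∫⁻ x in G, ‖u x - ⨍ y in G, u y‖ₑ ^ q ≤ c * localFractionalEnergy G p δ τ u ^ (q / p)

/-! The proof bounds |u(x) - u_B| pointwise, for a fixed ball B about the John centre, and then
integrates. Along the John curve of x, the balls of radius εt about γ(t), with t = Lθ^k, shrink to
x, and their averages tend to u(x) for almost every x by Lebesgue differentiation. Telescoping
bounds |u(x) - u_B| by a sum of differences of consecutive averages. Let g be the p-th root of the
inner energy integral, extended by zero off G, so that ‖g‖_p^p is the energy. Since dist(γ(t), ∂G) ≥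
t/c, two consecutive balls see each other inside the local balls B(a, τ dist(a, ∂G)), and their
averages differ by at most a constant times t^δ times the mean of g (`chain_step_le`). That mean is
controlled both by the maximal function Mg(x) and by t^(-n/p) ‖g‖_p. Summing the smaller of the two
bounds over the scales gives Hedberg's estimate |u(x) - u_B| ≤ C Mg(x)^(1-δp/n) ‖g‖_p^(δp/n)
(`tsum_min_mul_le`, `IsJohnDomain.exists_ae_enorm_sub_le`). Its power np/(n-δp) contains exactly
Mg^p, so the strong (p,p) maximal inequality gives the critical exponent. Hölder's inequality lowers
the exponent to q, and u_B is exchanged for u_G. -/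

/-! ### Layer cake formula. -/

theorem lintegral_rpow_layer_of_ne_top {s : ℝ} (hs : 0 < s) {a : ℝ≥0∞} (ha : a ≠ ∞) :
    ∫⁻ t in Set.Ioi (0 : ℝ), (if ENNReal.ofReal t < a then ENNReal.ofReal (t ^ (s - 1)) else 0) =
      a ^ s / ENNReal.ofReal s := by
  lift a to ℝ≥0 using ha
  calc ∫⁻ t in Set.Ioi (0 : ℝ),
        (if ENNReal.ofReal t < a then ENNReal.ofReal (t ^ (s - 1)) else 0)
      = ∫⁻ t in Set.Ioi (0 : ℝ),
          (Set.Iio (a : ℝ)).indicator (fun t => ENNReal.ofReal (t ^ (s - 1))) t := by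
        refine setLIntegral_congr_fun measurableSet_Ioi fun t ht => ?_
        simp only [Set.indicator, Set.mem_Iio]
        refine if_congr ?_ rfl rfl
        rw [← ENNReal.ofReal_coe_nnreal, ENNReal.ofReal_lt_ofReal_iff_of_nonneg (le_of_lt ht)]
    _ = ∫⁻ t in Set.Ioc (0 : ℝ) a, ENNReal.ofReal (t ^ (s - 1)) := by
        rw [lintegral_indicator measurableSet_Iio, Measure.restrict_restrict measurableSet_Iio,
          Set.inter_comm, Set.Ioi_inter_Iio, restrict_Ioo_eq_restrict_Ioc]
    _ = ENNReal.ofReal (∫ t in (0 : ℝ)..a, t ^ (s - 1)) := by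
        rw [intervalIntegral.integral_of_le a.coe_nonneg, ofReal_integral_eq_lintegral_ofReal]
        · exact (intervalIntegral.intervalIntegrable_rpow' (by linarith)).1
        · exact (ae_restrict_mem measurableSet_Ioc).mono fun t ht => Real.rpow_nonneg ht.1.le _
    _ = _ := by
        rw [integral_rpow (.inl (by linarith)), sub_add_cancel, Real.zero_rpow hs.ne', sub_zero,
          ENNReal.ofReal_div_of_pos hs, ← ENNReal.ofReal_rpow_of_nonneg a.coe_nonneg hs.le,
          ENNReal.ofReal_coe_nnreal]

/-- The layer cake formula for a single value. -/
theorem lintegral_rpow_layer {s : ℝ} (hs : 0 < s) (a : ℝ≥0∞) :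
    ∫⁻ t in Set.Ioi (0 : ℝ), (if ENNReal.ofReal t < a then ENNReal.ofReal (t ^ (s - 1)) else 0) =
      a ^ s / ENNReal.ofReal s := by
  by_cases ha : a = ∞
  · subst ha
    have htop : (∞ : ℝ≥0∞) ^ s / ENNReal.ofReal s = ∞ := by
      rw [ENNReal.top_rpow_of_pos hs, ENNReal.top_div_of_ne_top ENNReal.ofReal_ne_top]
    -- At a = ∞ the integral dominates its value at every finite b, and these values tend to ∞.
    have hlim : Filter.Tendsto (fun b : ℝ≥0 => (b : ℝ≥0∞) ^ s / ENNReal.ofReal s) Filter.atTop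
        (nhds ((∞ : ℝ≥0∞) ^ s / ENNReal.ofReal s)) :=
      ENNReal.Tendsto.div_const (((ENNReal.continuous_rpow_const (y := s)).tendsto _).comp <|
        ENNReal.tendsto_coe_nhds_top.2 Filter.tendsto_id) (.inl (by simp [hs]))
    rw [htop] at hlim ⊢
    rw [eq_top_iff]
    refine le_of_tendsto' hlim fun b => ?_
    rw [← lintegral_rpow_layer_of_ne_top hs ENNReal.coe_ne_top]
    refine lintegral_mono fun t => ?_
    simp only [ENNReal.ofReal_lt_top, if_true]
    split_ifs <;> simp
  · exact lintegral_rpow_layer_of_ne_top hs ha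

/-! ### The Hardy–Littlewood maximal inequality. -/

section MaximalFunction

variable {E : Type*} [NormedAddCommGroup E] [MeasurableSpace E] (μ : Measure E)

/-- The uncentred Hardy–Littlewood maximal function over balls of radius at most `R`. -/
noncomputable def maximalFunction (R : ℝ) (g : E → ℝ≥0∞) (x : E) : ℝ≥0∞ :=
  ⨆ (z : E) (r : ℝ) (_ : 0 < r ∧ r ≤ R ∧ x ∈ ball z r), ⨍⁻ y in closedBall z r, g y ∂μ

theorem laverage_le_maximalFunction {R r : ℝ} {z x : E} (g : E → ℝ≥0∞) (hr : 0 < r) (hR : r ≤ R)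
    (hx : x ∈ ball z r) : ⨍⁻ y in closedBall z r, g y ∂μ ≤ maximalFunction μ R g x :=
  le_iSup_of_le z <| le_iSup_of_le r <| le_iSup_of_le ⟨hr, hR, hx⟩ le_rfl

theorem lt_maximalFunction_iff {R : ℝ} {g : E → ℝ≥0∞} {x : E} {a : ℝ≥0∞} :
    a < maximalFunction μ R g x ↔
      ∃ (z : E) (r : ℝ), (0 < r ∧ r ≤ R ∧ x ∈ ball z r) ∧ a < ⨍⁻ y in closedBall z r, g y ∂μ := by
  simp only [maximalFunction, lt_iSup_iff, exists_prop]

/-- Superlevel sets are open: a ball that witnesses the bound at x is open and serves all nearby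
points too. -/
theorem measurable_maximalFunction [BorelSpace E] (R : ℝ) (g : E → ℝ≥0∞) :
    Measurable (maximalFunction μ R g) := by
  refine measurable_of_Ioi fun a => IsOpen.measurableSet ?_
  rw [Metric.isOpen_iff]
  intro x hx
  obtain ⟨z, r, ⟨hr, hR, hxz⟩, ha⟩ := (lt_maximalFunction_iff μ).1 hx
  obtain ⟨ε, hε, hb⟩ := Metric.isOpen_iff.1 (isOpen_ball (x := z) (ε := r)) x hxz
  exact ⟨ε, hε, fun y hy => (lt_maximalFunction_iff μ).2 ⟨z, r, ⟨hr, hR, hb hy⟩, ha⟩⟩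

variable [NormedSpace ℝ E] [FiniteDimensional ℝ E] [μ.IsAddHaarMeasure]

/-- Truncation for Marcinkiewicz interpolation: the part of g below height a contributes at most a
to any average. -/
theorem maximalFunction_le_add (R : ℝ) {g : E → ℝ≥0∞} (hg : Measurable g) (a : ℝ≥0∞) (x : E) :
    maximalFunction μ R g x ≤ maximalFunction μ R ({y | a < g y}.indicator g) x + a := by
  refine iSup_le fun z => iSup_le fun r => iSup_le fun h => ?_
  have hm : MeasurableSet {y | a < g y} := measurableSet_lt measurable_const hg
  calc ⨍⁻ y in closedBall z r, g y ∂μ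
      ≤ ⨍⁻ y in closedBall z r, ({y | a < g y}.indicator g y + a) ∂μ := by
        refine lintegral_mono fun y => ?_
        by_cases hy : a < g y
        · simp [Set.indicator, hy]
        · simpa [Set.indicator, hy] using not_lt.1 hy
    _ = (⨍⁻ y in closedBall z r, {y | a < g y}.indicator g y ∂μ) +
          ⨍⁻ y in closedBall z r, a ∂μ := by
        simp only [laverage]
        rw [lintegral_add_left (hg.indicator hm)]
    _ ≤ _ := by
        gcongr
        · exact laverage_le_maximalFunction μ _ h.1 h.2.1 h.2.2
        · rw [setLAverage_const (measure_closedBall_pos μ _ h.1).ne' measure_closedBall_lt_top.ne]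

variable [BorelSpace E]

/-- The weak type `(1,1)` inequality. -/
theorem measure_lt_maximalFunction_le (R : ℝ) (g : E → ℝ≥0∞) {a : ℝ≥0∞} (ha : a ≠ 0)
    (ha' : a ≠ ∞) :
    μ {x | a < maximalFunction μ R g x} ≤
      ENNReal.ofReal (4 ^ Module.finrank ℝ E) * (a⁻¹ * ∫⁻ x, g x ∂μ) := by
  let t : Set (E × ℝ) := {b | 0 < b.2 ∧ b.2 ≤ R ∧ a < ⨍⁻ y in closedBall b.1 b.2, g y ∂μ}
  -- The bound R on the radii is what makes Vitali's covering lemma applicable. It allows any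
  -- enlargement factor above 3, here 4.
  obtain ⟨u, hut, hd, hc⟩ := Vitali.exists_disjoint_subfamily_covering_enlargement_closedBall t
    (fun b => b.1) (fun b => b.2) R (fun b hb => hb.2.1) 4 (by norm_num)
  have hucount : u.Countable := hd.countable_of_nonempty_interior fun b hb =>
    ⟨b.1, interior_mono ball_subset_closedBall (by
      rw [isOpen_ball.interior_eq]; exact mem_ball_self (hut hb).1)⟩
  have hsub : {x | a < maximalFunction μ R g x} ⊆ ⋃ b ∈ u, closedBall b.1 (4 * b.2) := by
    intro x hx
    obtain ⟨z, r, ⟨hr, hR, hxz⟩, h⟩ := (lt_maximalFunction_iff μ).1 hx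
    obtain ⟨b, hb, hzb⟩ := hc (z, r) ⟨hr, hR, h⟩
    exact Set.mem_biUnion hb (hzb (ball_subset_closedBall hxz))
  have hball (b) (hb : b ∈ u) : μ (closedBall b.1 (4 * b.2)) ≤
      ENNReal.ofReal (4 ^ Module.finrank ℝ E) * (a⁻¹ * ∫⁻ y in closedBall b.1 b.2, g y ∂μ) := by
    obtain ⟨h0, -, h⟩ := hut hb
    rw [Measure.addHaar_closedBall_mul μ _ (by norm_num) h0.le,
      ← Measure.addHaar_closedBall_center μ b.1]
    gcongr
    rw [setLAverage_eq, ENNReal.lt_div_iff_mul_lt] at h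
    · rw [mul_comm, ← div_eq_mul_inv, ENNReal.le_div_iff_mul_le (.inl ha) (.inl ha'), mul_comm]
      simpa using h.le
    · exact .inl (measure_closedBall_pos μ _ h0).ne'
    · exact .inl measure_closedBall_lt_top.ne
  calc _ ≤ μ (⋃ b ∈ u, closedBall b.1 (4 * b.2)) := measure_mono hsub
    _ ≤ ∑' b : u, μ (closedBall b.1.1 (4 * b.1.2)) := measure_biUnion_le μ hucount _
    _ ≤ ∑' b : u, ENNReal.ofReal (4 ^ Module.finrank ℝ E) *
        (a⁻¹ * ∫⁻ y in closedBall b.1.1 b.1.2, g y ∂μ) := ENNReal.tsum_le_tsum fun b => hball b b.2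
    _ = ENNReal.ofReal (4 ^ Module.finrank ℝ E) *
        (a⁻¹ * ∫⁻ y in ⋃ b ∈ u, closedBall b.1 b.2, g y ∂μ) := by
      rw [ENNReal.tsum_mul_left, ENNReal.tsum_mul_left,
        lintegral_biUnion hucount (fun b _ => measurableSet_closedBall) hd]
    _ ≤ _ := by gcongr; exact Measure.restrict_le_self

/-- The strong type `(p,p)` inequality, with a constant independent of the radius bound. -/
theorem lintegral_maximalFunction_rpow_le {p : ℝ} (hp : 1 < p) :
    ∃ C : ℝ≥0, ∀ (R : ℝ) (g : E → ℝ≥0∞), Measurable g →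
      ∫⁻ x, maximalFunction μ R g x ^ p ∂μ ≤ C * ∫⁻ x, g x ^ p ∂μ := by
  have hp0 : 0 < p := by linarith
  have hp1 : 0 < p - 1 := by linarith
  set c : ℝ≥0∞ := ENNReal.ofReal (4 ^ Module.finrank ℝ E) with hc
  let K : ℝ≥0∞ := ENNReal.ofReal p * (c * 2 * (2 ^ (p - 1) / ENNReal.ofReal (p - 1)))
  have hK : K ≠ ∞ := by
    refine ENNReal.mul_ne_top ENNReal.ofReal_ne_top (ENNReal.mul_ne_top
      (ENNReal.mul_ne_top ENNReal.ofReal_ne_top (by simp)) (ENNReal.div_ne_top ?_ (by simpa)))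
    exact ENNReal.rpow_ne_top_of_nonneg hp1.le (by simp)
  refine ⟨K.toNNReal, fun R g hg => ?_⟩
  rw [ENNReal.coe_toNNReal hK]
  have hM := measurable_maximalFunction μ R g
  -- Where Mg > t, the part of g above t/2 already has maximal function above t/2; the weak type
  -- bound is applied to that part.
  have key (t : ℝ) (ht : 0 < t) : μ {x | ENNReal.ofReal t < maximalFunction μ R g x} ≤
      c * ((ENNReal.ofReal t)⁻¹ * 2 * ∫⁻ x in {y | ENNReal.ofReal t < 2 * g y}, g x ∂μ) := by
    have ht0 : ENNReal.ofReal t ≠ 0 := by simpa using ht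
    have hset : {y | ENNReal.ofReal t / 2 < g y} = {y | ENNReal.ofReal t < 2 * g y} := by
      ext y
      simp only [Set.mem_ofPred_eq]
      rw [ENNReal.div_lt_iff (by simp) (by simp), mul_comm]
    have hm : MeasurableSet {y | ENNReal.ofReal t < 2 * g y} :=
      measurableSet_lt measurable_const (hg.const_mul 2)
    calc μ {x | ENNReal.ofReal t < maximalFunction μ R g x}
        ≤ μ {x | ENNReal.ofReal t / 2 <
            maximalFunction μ R ({y | ENNReal.ofReal t / 2 < g y}.indicator g) x} := by
          refine measure_mono fun x hx => ?_
          have h := lt_of_lt_of_le hx (maximalFunction_le_add μ R hg (ENNReal.ofReal t / 2) x)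
          by_contra hcon
          refine absurd h (not_lt.2 ?_)
          calc _ ≤ ENNReal.ofReal t / 2 + ENNReal.ofReal t / 2 := by
                gcongr; exact not_lt.1 hcon
            _ = _ := ENNReal.add_halves _
      _ ≤ c * ((ENNReal.ofReal t / 2)⁻¹ *
            ∫⁻ x, {y | ENNReal.ofReal t / 2 < g y}.indicator g x ∂μ) :=
          measure_lt_maximalFunction_le μ R _ (by simpa using ht)
            (ENNReal.div_ne_top ENNReal.ofReal_ne_top (by simp))
      _ = _ := by
          rw [hset, lintegral_indicator hm, ENNReal.inv_div (by simp) (.inl (by simp)),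
            div_eq_mul_inv, mul_comm (2 : ℝ≥0∞)]
  have hswap (f : E → ℝ≥0∞) (hf : Measurable f) (s : ℝ) : Measurable
      (Function.uncurry fun (x : E) (t : ℝ) =>
        if ENNReal.ofReal t < f x then ENNReal.ofReal (t ^ s) else 0) := by
    refine Measurable.ite (measurableSet_lt ?_ ?_) ?_ measurable_const <;> fun_prop
  have hlayer (a : ℝ≥0∞) : a ^ p = ENNReal.ofReal p * ∫⁻ t in Set.Ioi (0 : ℝ),
      (if ENNReal.ofReal t < a then ENNReal.ofReal (t ^ (p - 1)) else 0) := by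
    rw [lintegral_rpow_layer hp0, ENNReal.mul_div_cancel (by simpa using hp0) ENNReal.ofReal_ne_top]
  calc ∫⁻ x, maximalFunction μ R g x ^ p ∂μ
      = ENNReal.ofReal p * ∫⁻ t in Set.Ioi (0 : ℝ), ∫⁻ x, (if ENNReal.ofReal t <
          maximalFunction μ R g x then ENNReal.ofReal (t ^ (p - 1)) else 0) ∂μ := by
        simp_rw [hlayer]
        rw [lintegral_const_mul' _ _ ENNReal.ofReal_ne_top,
          lintegral_lintegral_swap (hswap _ hM _).aemeasurable]
    _ ≤ ENNReal.ofReal p * ∫⁻ t in Set.Ioi (0 : ℝ), c * 2 * ∫⁻ x, g x *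
          (if ENNReal.ofReal t < 2 * g x then ENNReal.ofReal (t ^ (p - 1 - 1)) else 0) ∂μ := by
        refine mul_le_mul_right (setLIntegral_mono' measurableSet_Ioi fun t ht => ?_) _
        have ht : 0 < t := ht
        have hm : MeasurableSet {y | ENNReal.ofReal t < 2 * g y} :=
          measurableSet_lt measurable_const (hg.const_mul 2)
        have hm' : MeasurableSet {x | ENNReal.ofReal t < maximalFunction μ R g x} :=
          measurableSet_lt measurable_const hM
        have e1 : ∫⁻ x, (if ENNReal.ofReal t < maximalFunction μ R g x then
            ENNReal.ofReal (t ^ (p - 1)) else 0) ∂μ = ENNReal.ofReal (t ^ (p - 1)) *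
              μ {x | ENNReal.ofReal t < maximalFunction μ R g x} := by
          rw [← lintegral_indicator_const hm']
          simp only [Set.indicator, Set.mem_ofPred_eq]
        have e2 : ∫⁻ x, g x * (if ENNReal.ofReal t < 2 * g x then
            ENNReal.ofReal (t ^ (p - 1 - 1)) else 0) ∂μ = ENNReal.ofReal (t ^ (p - 1 - 1)) *
              ∫⁻ x in {y | ENNReal.ofReal t < 2 * g y}, g x ∂μ := by
          rw [← lintegral_indicator hm, ← lintegral_const_mul' _ _ ENNReal.ofReal_ne_top]
          refine lintegral_congr fun x => ?_
          by_cases hx : ENNReal.ofReal t < 2 * g x <;> simp [Set.indicator, mul_comm]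
        have e3 : ENNReal.ofReal (t ^ (p - 1 - 1)) =
            ENNReal.ofReal (t ^ (p - 1)) * (ENNReal.ofReal t)⁻¹ := by
          rw [Real.rpow_sub_one ht.ne', ENNReal.ofReal_div_of_pos ht, div_eq_mul_inv]
        rw [e1, e2, e3]
        calc _ ≤ _ := mul_le_mul_right (key t ht) _
          _ = _ := by ring
    _ = K * ∫⁻ x, g x ^ p ∂μ := by
        have hm2 : Measurable (Function.uncurry fun (x : E) (t : ℝ) => g x *
            (if ENNReal.ofReal t < 2 * g x then ENNReal.ofReal (t ^ (p - 1 - 1)) else 0)) :=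
          (hg.comp measurable_fst).mul (hswap _ (hg.const_mul 2) _)
        rw [lintegral_const_mul' _ _ (ENNReal.mul_ne_top ENNReal.ofReal_ne_top (by simp)),
          ← lintegral_lintegral_swap hm2.aemeasurable]
        -- After the order of integration is exchanged, the layer cake formula with exponent p - 1 >
        -- 0 evaluates the t-integral.
        have e4 (x : E) : ∫⁻ t in Set.Ioi (0 : ℝ), g x *
            (if ENNReal.ofReal t < 2 * g x then ENNReal.ofReal (t ^ (p - 1 - 1)) else 0) =
            2 ^ (p - 1) / ENNReal.ofReal (p - 1) * g x ^ p := by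
          rw [lintegral_const_mul _ ((hswap _ (hg.const_mul 2) _).of_uncurry_left (x := x)),
            lintegral_rpow_layer hp1, ENNReal.mul_rpow_of_nonneg _ _ hp1.le]
          have : g x ^ p = g x * g x ^ (p - 1) := by
            conv_lhs => rw [show p = 1 + (p - 1) by ring]
            rw [ENNReal.rpow_add_of_nonneg _ _ zero_le_one hp1.le, ENNReal.rpow_one]
          rw [this]
          simp only [div_eq_mul_inv]
          ring
        simp_rw [e4]
        rw [lintegral_const_mul _ (hg.pow_const p)]
        simp only [K]
        ring

end MaximalFunction

/-! ### Averages and their differences. -/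

section Averages

variable {E : Type*} [MeasurableSpace E] {μ : Measure E} {s : Set E}

theorem enorm_setAverage_sub_le (h0 : μ s ≠ 0) (hs : μ s ≠ ∞) {f : E → ℝ}
    (hf : IntegrableOn f s μ) (c : ℝ) :
    ‖(⨍ x in s, f x ∂μ) - c‖ₑ ≤ ⨍⁻ x in s, ‖f x - c‖ₑ ∂μ := by
  conv_lhs => rw [← setAverage_const h0 hs c]
  simp only [average, laverage]
  have hi : Integrable f ((μ.restrict s Set.univ)⁻¹ • μ.restrict s) :=
    hf.smul_measure (by simpa using h0)
  have hc : Integrable (fun _ : E => c) ((μ.restrict s Set.univ)⁻¹ • μ.restrict s) :=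
    (integrableOn_const hs).smul_measure (by simpa using h0)
  rw [← integral_sub hi hc]
  exact enorm_integral_le_lintegral_enorm fun x => f x - c

/-- Jensen's inequality, obtained from Hölder's inequality against the constant 1 for the normalized
measure. -/
theorem setLAverage_rpow_le (h0 : μ s ≠ 0) (hs : μ s ≠ ∞) {p : ℝ} (hp : 1 < p) {f : E → ℝ≥0∞}
    (hf : Measurable f) : (⨍⁻ x in s, f x ∂μ) ^ p ≤ ⨍⁻ x in s, f x ^ p ∂μ := by
  have hp0 : 0 < p := by linarith
  have h := ENNReal.lintegral_mul_le_Lp_mul_Lq ((μ.restrict s Set.univ)⁻¹ • μ.restrict s)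
    (Real.HolderConjugate.conjExponent hp) hf.aemeasurable (aemeasurable_const (b := (1 : ℝ≥0∞)))
  have h1 : (μ s)⁻¹ * μ s = 1 := ENNReal.inv_mul_cancel h0 hs
  simp only [Pi.mul_apply, mul_one, ENNReal.one_rpow, lintegral_const, Measure.smul_apply,
    Measure.restrict_apply_univ, smul_eq_mul, h1] at h
  simp only [laverage, Measure.restrict_apply_univ]
  calc _ ≤ _ := ENNReal.rpow_le_rpow h hp0.le
    _ = _ := by rw [← ENNReal.rpow_mul, one_div_mul_cancel hp0.ne', ENNReal.rpow_one]

theorem setLAverage_le_div_mul {t : Set E} (hst : s ⊆ t) (h0 : μ t ≠ 0) (ht : μ t ≠ ∞)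
    (f : E → ℝ≥0∞) : ⨍⁻ x in s, f x ∂μ ≤ μ t / μ s * ⨍⁻ x in t, f x ∂μ := by
  rw [setLAverage_eq, setLAverage_eq]
  calc (∫⁻ x in s, f x ∂μ) / μ s ≤ (∫⁻ x in t, f x ∂μ) / μ s := by gcongr
    _ = μ t * ((∫⁻ x in t, f x ∂μ) / μ t) / μ s := by rw [ENNReal.mul_div_cancel h0 ht]
    _ = _ := by simp only [div_eq_mul_inv]; ring

end Averages

/-- Two averages of `v` differ by at most an average of a local fractional difference. -/
theorem enorm_setAverage_sub_setAverage_le {E : Type*} [NormedAddCommGroup E] [MeasurableSpace E]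
    {μ : Measure E} {A B : Set E} (hA0 : μ A ≠ 0) (hA : μ A ≠ ∞)
    (hB0 : μ B ≠ 0) (hB : μ B ≠ ∞) (hAm : MeasurableSet A) (hBm : MeasurableSet B)
    {v : E → ℝ} (hv : Measurable v) (hvA : IntegrableOn v A μ) (hvB : IntegrableOn v B μ)
    {p s : ℝ} (hp : 1 < p) (hs : 0 ≤ s) {r : ℝ≥0∞} (hr' : r ≠ ∞) (S : E → Set E)
    (hS : ∀ a ∈ A, B ⊆ S a) (hr : ∀ a ∈ A, ∀ b ∈ B, ‖a - b‖ₑ ≤ r) :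
    ‖(⨍ x in A, v x ∂μ) - ⨍ x in B, v x ∂μ‖ₑ ≤ (r ^ s / μ B) ^ (1 / p) *
      ⨍⁻ a in A, (∫⁻ b in S a, ‖v a - v b‖ₑ ^ p / ‖a - b‖ₑ ^ s ∂μ) ^ (1 / p) ∂μ := by
  have hp0 : 0 < p := by linarith
  have hrs : r ^ s ≠ ∞ := ENNReal.rpow_ne_top_of_nonneg hs hr'
  -- For fixed a, Jensen moves the power inside the mean over B; the kernel is then inserted at the
  -- cost of |a - b|^s ≤ r^s.
  have hle : ⨍⁻ a in A, ‖v a - ⨍ x in B, v x ∂μ‖ₑ ∂μ ≤ ⨍⁻ a in A, (r ^ s / μ B) ^ (1 / p) *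
      (∫⁻ b in S a, ‖v a - v b‖ₑ ^ p / ‖a - b‖ₑ ^ s ∂μ) ^ (1 / p) ∂μ := by
    simp only [setLAverage_eq]
    refine ENNReal.div_le_div_right (setLIntegral_mono' hAm fun a ha => ?_) _
    rw [← ENNReal.mul_rpow_of_nonneg _ _ (by positivity), one_div, ENNReal.le_rpow_inv_iff hp0]
    calc ‖v a - ⨍ x in B, v x ∂μ‖ₑ ^ p ≤ (⨍⁻ b in B, ‖v b - v a‖ₑ ∂μ) ^ p := by
          rw [enorm_sub_rev]
          exact ENNReal.rpow_le_rpow (enorm_setAverage_sub_le hB0 hB hvB _) hp0.le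
      _ ≤ ⨍⁻ b in B, ‖v b - v a‖ₑ ^ p ∂μ :=
          setLAverage_rpow_le hB0 hB hp (hv.sub_const _).enorm
      _ ≤ (∫⁻ b in B, r ^ s * (‖v a - v b‖ₑ ^ p / ‖a - b‖ₑ ^ s) ∂μ) / μ B := by
          rw [setLAverage_eq]
          refine ENNReal.div_le_div_right (setLIntegral_mono' hBm fun b hb => ?_) _
          rw [enorm_sub_rev]
          by_cases hab : a = b
          · simp [hab, hp0]
          have hab' : ‖a - b‖ₑ ≠ 0 := by simpa [sub_eq_zero] using hab
          calc ‖v a - v b‖ₑ ^ p = ‖a - b‖ₑ ^ s * (‖v a - v b‖ₑ ^ p / ‖a - b‖ₑ ^ s) := by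
                rw [ENNReal.mul_div_cancel]
                · exact (ENNReal.rpow_pos (pos_iff_ne_zero.2 hab') enorm_ne_top).ne'
                · exact ENNReal.rpow_ne_top_of_nonneg hs enorm_ne_top
            _ ≤ _ := by gcongr; exact hr a ha b hb
      _ = r ^ s / μ B * ∫⁻ b in B, ‖v a - v b‖ₑ ^ p / ‖a - b‖ₑ ^ s ∂μ := by
          rw [lintegral_const_mul' _ _ hrs]
          simp only [div_eq_mul_inv]
          ring
      _ ≤ _ := by gcongr; exact hS a ha
  calc _ ≤ _ := enorm_setAverage_sub_le hA0 hA hvA _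
    _ ≤ _ := hle
    _ = _ := by
      simp only [setLAverage_eq]
      rw [lintegral_const_mul' _ _ (ENNReal.rpow_ne_top_of_nonneg (by positivity) (ENNReal.div_ne_top hrs hB0)),
        mul_div_assoc]

/-! ### Summation over scales. -/

section Hedberg

/-- The power δ decays as s → 0 and the power -β as s → ∞, so the minimum decays geometrically in
both directions of the scale j. -/
theorem min_rpow_le_geometric {θ δ β s : ℝ} (hθ : 0 < θ) (hθ1 : θ < 1) (hδ : 0 < δ) (hβ : 0 < β)
    {j : ℤ} (h1 : θ ^ (j + 1) < s) (h2 : s ≤ θ ^ j) :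
    min (s ^ δ) (s ^ (-β)) ≤ (θ ^ min δ β)⁻¹ * (θ ^ min δ β) ^ j.natAbs := by
  have hs : 0 < s := (zpow_pos hθ _).trans h1
  have hη : 0 < θ ^ min δ β := Real.rpow_pos_of_pos hθ _
  have hη1 : θ ^ min δ β ≤ 1 := Real.rpow_le_one hθ.le hθ1.le (by positivity)
  -- For j = -(i + 1) only s > θ^(-i) is available, one step short of |j|; the prefactor (θ^min δ
  -- β)⁻¹ absorbs the loss.
  obtain ⟨i, rfl | rfl⟩ : ∃ i : ℕ, j = i ∨ j = -(i + 1 : ℕ) := by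
    rcases j with i | i
    · exact ⟨i, .inl rfl⟩
    · exact ⟨i, .inr rfl⟩
  · refine (min_le_left _ _).trans ?_
    calc s ^ δ ≤ (θ ^ i) ^ δ := Real.rpow_le_rpow hs.le (by simpa using h2) hδ.le
      _ = (θ ^ δ) ^ i := Real.rpow_pow_comm hθ.le _ _ |>.symm
      _ ≤ (θ ^ min δ β) ^ i := pow_le_pow_left₀ (by positivity)
          (Real.rpow_le_rpow_of_exponent_ge hθ hθ1.le (min_le_left _ _)) _
      _ ≤ _ := by
          rw [Int.natAbs_natCast]
          exact le_mul_of_one_le_left (by positivity) ((one_le_inv₀ hη).2 hη1)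
  · refine (min_le_right _ _).trans ?_
    have h1' : (θ ^ i)⁻¹ ≤ s := by
      rw [show (-((i + 1 : ℕ) : ℤ) + 1) = -(i : ℤ) by push_cast; ring, zpow_neg, zpow_natCast] at h1
      exact h1.le
    calc s ^ (-β) ≤ ((θ ^ i)⁻¹) ^ (-β) :=
          Real.rpow_le_rpow_of_nonpos (by positivity) h1' (by linarith)
      _ = (θ ^ β) ^ i := by
          rw [Real.rpow_neg (by positivity), Real.inv_rpow (by positivity), inv_inv,
            Real.rpow_pow_comm hθ.le]
      _ ≤ (θ ^ min δ β) ^ i := pow_le_pow_left₀ (by positivity)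
          (Real.rpow_le_rpow_of_exponent_ge hθ hθ1.le (min_le_right _ _)) _
      _ = _ := by
          rw [Int.natAbs_neg, Int.natAbs_natCast, pow_succ']
          field_simp

/-- Uniform in s, because up to a bounded factor s is a power of θ and merely shifts the index
inside a convergent series over ℤ. -/
theorem tsum_min_rpow_le {θ δ β : ℝ} (hθ : 0 < θ) (hθ1 : θ < 1) (hδ : 0 < δ) (hβ : 0 < β) :
    ∃ C : ℝ≥0, ∀ s : ℝ, 0 < s →
      ∑' k : ℕ, ENNReal.ofReal (min ((s * θ ^ k) ^ δ) ((s * θ ^ k) ^ (-β))) ≤ C := by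
  set η := θ ^ min δ β with hηdef
  have hη : 0 < η := Real.rpow_pos_of_pos hθ _
  have hη1 : η < 1 := Real.rpow_lt_one hθ.le hθ1 (lt_min hδ hβ)
  have hsum : Summable fun j : ℤ => η⁻¹ * η ^ j.natAbs := by
    refine Summable.mul_left _ (Summable.of_nat_of_neg ?_ ?_) <;>
      simpa using summable_geometric_of_lt_one hη.le hη1
  have hfin : ∑' j : ℤ, ENNReal.ofReal (η⁻¹ * η ^ j.natAbs) ≠ ∞ := hsum.tsum_ofReal_ne_top
  refine ⟨(∑' j : ℤ, ENNReal.ofReal (η⁻¹ * η ^ j.natAbs)).toNNReal, fun s hs => ?_⟩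
  rw [ENNReal.coe_toNNReal hfin]
  obtain ⟨m, hm1, hm2⟩ := exists_mem_Ioc_zpow hs (one_lt_inv₀ hθ |>.2 hθ1)
  calc _ ≤ ∑' k : ℕ, ENNReal.ofReal (η⁻¹ * η ^ ((k : ℤ) - m - 1).natAbs) := by
        refine ENNReal.tsum_le_tsum fun k => ENNReal.ofReal_le_ofReal ?_
        have hk : 0 < θ ^ k := pow_pos hθ k
        refine min_rpow_le_geometric hθ hθ1 hδ hβ ?_ ?_
        · calc θ ^ ((k : ℤ) - m - 1 + 1) = θ⁻¹ ^ m * θ ^ k := by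
                rw [inv_zpow', ← zpow_natCast, ← zpow_add₀ hθ.ne']; congr 1; ring
            _ < _ := by gcongr
        · calc s * θ ^ k ≤ θ⁻¹ ^ (m + 1) * θ ^ k := by gcongr
            _ = _ := by
                rw [inv_zpow', ← zpow_natCast, ← zpow_add₀ hθ.ne']; congr 1; ring
    _ ≤ _ := ENNReal.tsum_comp_le_tsum_of_injective (f := fun k : ℕ => (k : ℤ) - m - 1)
        (fun a b h => by simpa using h) fun j : ℤ => ENNReal.ofReal (η⁻¹ * η ^ j.natAbs)

/-- Hedberg's interpolation between a bound at small scales and a bound at large scales. -/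
theorem tsum_min_mul_le {L θ δ β : ℝ} (hL : 0 < L) (hθ : 0 < θ) (hθ1 : θ < 1) (hδ : 0 < δ)
    (hβ : 0 < β) :
    ∃ C : ℝ≥0, ∀ M N : ℝ≥0∞,
      ∑' k : ℕ, min (ENNReal.ofReal ((L * θ ^ k) ^ δ) * M)
          (ENNReal.ofReal ((L * θ ^ k) ^ (-β)) * N) ≤
        C * (M ^ (β / (δ + β)) * N ^ (δ / (δ + β))) := by
  obtain ⟨C, hC⟩ := tsum_min_rpow_le hθ hθ1 hδ hβ
  have hδβ : 0 < δ + β := by positivity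
  have hb : 0 < β / (δ + β) := by positivity
  have hd : 0 < δ / (δ + β) := by positivity
  -- The added 1 makes the constant nonzero, so that the right side is ∞ when M or N is ∞ and
  -- neither is 0.
  refine ⟨C + 1, fun M N => ?_⟩
  by_cases hM0 : M = 0
  · simp [hM0]
  by_cases hN0 : N = 0
  · simp [hN0]
  by_cases hM : M = ∞
  · rw [hM, ENNReal.top_rpow_of_pos hb, ENNReal.top_mul (by simp [hN0, hd.le]), ENNReal.mul_top]
    · exact le_top
    · simp
  by_cases hN : N = ∞
  · rw [hN, ENNReal.top_rpow_of_pos hd, ENNReal.mul_top (by simp [hM0, hb.le]), ENNReal.mul_top]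
    · exact le_top
    · simp
  obtain ⟨a, ha, rfl⟩ : ∃ a : ℝ, 0 < a ∧ ENNReal.ofReal a = M :=
    ⟨M.toReal, ENNReal.toReal_pos hM0 hM, ENNReal.ofReal_toReal hM⟩
  obtain ⟨b, hb', rfl⟩ : ∃ b : ℝ, 0 < b ∧ ENNReal.ofReal b = N :=
    ⟨N.toReal, ENNReal.toReal_pos hN0 hN, ENNReal.ofReal_toReal hN⟩
  set S : ℝ := a ^ (β / (δ + β)) * b ^ (δ / (δ + β)) with hS
  have hSpos : 0 < S := by positivity
  -- The crossover scale, at which the two bounds agree with common value S. Rescaling by r reduces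
  -- to a = b = 1.
  set r : ℝ := (b / a) ^ (1 / (δ + β)) with hr
  have hrpos : 0 < r := by positivity
  have h1 : r ^ δ * a = S := by
    rw [hr, ← Real.rpow_mul (by positivity), Real.div_rpow hb'.le ha.le, hS,
      show β / (δ + β) = 1 - δ / (δ + β) by field_simp; ring, Real.rpow_sub ha, Real.rpow_one,
      one_div_mul_eq_div]
    field_simp
  have h2 : r ^ (-β) * b = S := by
    rw [hr, ← Real.rpow_mul (by positivity), Real.div_rpow hb'.le ha.le, hS,
      show δ / (δ + β) = 1 - β / (δ + β) by field_simp; ring, Real.rpow_sub hb', Real.rpow_one,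
      mul_neg, one_div_mul_eq_div, Real.rpow_neg ha.le, Real.rpow_neg hb'.le]
    field_simp
  have hS' : ENNReal.ofReal a ^ (β / (δ + β)) * ENNReal.ofReal b ^ (δ / (δ + β)) =
      ENNReal.ofReal S := by
    rw [hS, ENNReal.ofReal_mul (by positivity), ENNReal.ofReal_rpow_of_pos ha,
      ENNReal.ofReal_rpow_of_pos hb']
  calc _ = ∑' k : ℕ, ENNReal.ofReal S *
        ENNReal.ofReal (min ((L / r * θ ^ k) ^ δ) ((L / r * θ ^ k) ^ (-β))) := by
        refine tsum_congr fun k => ?_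
        have hk : 0 < L * θ ^ k := by positivity
        rw [← ENNReal.ofReal_mul (by positivity), ← ENNReal.ofReal_mul (by positivity),
          ← ENNReal.ofReal_mul hSpos.le, ← ENNReal.ofReal_min, mul_min_of_nonneg _ _ hSpos.le,
          show L / r * θ ^ k = L * θ ^ k / r by ring, Real.div_rpow hk.le hrpos.le,
          Real.div_rpow hk.le hrpos.le]
        congr 2
        · rw [← h1]; field_simp
        · rw [← h2]; field_simp
    _ ≤ ENNReal.ofReal S * C := by
        rw [ENNReal.tsum_mul_left]
        gcongr
        exact hC _ (by positivity)
    _ ≤ _ := by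
        rw [hS', mul_comm]
        gcongr
        exact_mod_cast le_add_of_nonneg_right zero_le_one

end Hedberg

/-! ### Distance to the boundary and John curves. -/

section Geometry

variable {n : ℕ} {G : Set (EuclideanSpace ℝ (Fin n))}

/-- The ball is connected, meets G and misses the frontier, so it cannot reach the complement of the
closure. -/
theorem closedBall_subset_of_lt_infDist_frontier {z : EuclideanSpace ℝ (Fin n)} {r : ℝ}
    (hG : IsOpen G) (hz : z ∈ G) (hr : 0 ≤ r) (h : r < infDist z (frontier G)) : closedBall z r ⊆ G := by
  have hd : Disjoint (closedBall z r) (frontier G) := by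
    refine Set.disjoint_left.2 fun y hy hyf => ?_
    have := infDist_le_dist_of_mem (x := z) hyf
    rw [mem_closedBall'] at hy
    linarith
  refine (convex_closedBall z r).isPreconnected.subset_left_of_subset_union hG
    isClosed_closure.isOpen_compl (disjoint_compl_right.mono_left subset_closure) (fun y hy => ?_)
    ⟨z, mem_closedBall_self hr, hz⟩
  by_contra hcon
  simp only [Set.mem_union, Set.mem_compl_iff, not_or, not_not] at hcon
  refine Set.disjoint_left.1 hd hy ?_
  rw [hG.frontier_eq]
  exact ⟨hcon.2, hcon.1⟩

theorem HasUnitSpeedOn.dist_le {γ : ℝ → EuclideanSpace ℝ (Fin n)} {S : Set ℝ}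
    (h : HasUnitSpeedOn γ S) {s t : ℝ} (hs : s ∈ S) (ht : t ∈ S) (hst : s ≤ t) :
    dist (γ s) (γ t) ≤ t - s := by
  have h1 := eVariationOn.edist_le γ (s := S ∩ Set.Icc s t) ⟨hs, le_rfl, hst⟩ ⟨ht, hst, le_rfl⟩
  rw [h hs ht, NNReal.coe_one, one_mul, edist_dist] at h1
  exact (ENNReal.ofReal_le_ofReal_iff (by linarith)).1 h1

/-- The frontier must be shown nonempty, since `infDist` to the empty set is 0; it is nonempty
because a bounded G is not the whole space. -/
theorem IsBoundedDomain.infDist_frontier_pos (hn : 2 ≤ n) (hG : IsBoundedDomain G)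
    {x : EuclideanSpace ℝ (Fin n)} (hx : x ∈ G) : 0 < infDist x (frontier G) := by
  have : Nonempty (Fin n) := ⟨⟨0, by omega⟩⟩
  have hne : (frontier G).Nonempty := by
    rw [nonempty_frontier_iff]
    refine ⟨⟨x, hx⟩, fun h => ?_⟩
    have := hG.isBounded
    rw [h] at this
    exact NormedSpace.unbounded_univ ℝ _ this
  refine (isClosed_frontier.notMem_iff_infDist_pos hne).1 fun h => ?_
  rw [hG.isOpen.frontier_eq] at h
  exact h.2 hx

/-- In a John domain the curves can be taken `1`-Lipschitz on a common parameter interval. -/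
theorem IsJohnDomain.exists_lipschitz_curve (hn : 2 ≤ n) (hG : IsJohnDomain 1 G) :
    ∃ x₀ ∈ G, ∃ c > 0, ∃ L > 0, ∀ x ∈ G, ∃ γ : ℝ → EuclideanSpace ℝ (Fin n),
      γ 0 = x ∧ γ L = x₀ ∧
      (∀ s t, 0 ≤ s → s ≤ t → t ≤ L → dist (γ s) (γ t) ≤ t - s) ∧
      ∀ t, 0 ≤ t → t ≤ L → γ t ∈ G ∧ t / c ≤ infDist (γ t) (frontier G) := by
  obtain ⟨-, hbd, x₀, hx₀, c, hc, H⟩ := hG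
  have hd0 := hbd.infDist_frontier_pos hn hx₀
  set d := infDist x₀ (frontier G) with hd
  -- Each curve rests at x₀ after time l, up to the common time c. There the distance is d, and t ≤
  -- c = d (c / d) explains the second constant.
  refine ⟨x₀, hx₀, max c (c / d), lt_max_of_lt_left hc, c, hc, fun x hx => ?_⟩
  obtain ⟨l, γ, hl, hlc, hγG, hsp, h0, h1, hJ⟩ := H x hx
  refine ⟨fun t => γ (min t l), by simp [hl, h0], by simp [hlc, h1], fun s t hs hst ht => ?_,
    fun t ht htc => ?_⟩
  · have := hsp.dist_le (s := min s l) (t := min t l) ⟨le_min hs hl, min_le_right _ _⟩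
      ⟨le_min (hs.trans hst) hl, min_le_right _ _⟩ (min_le_min_right _ hst)
    refine this.trans ?_
    rcases le_total t l with h | h <;> rcases le_total s l with h' | h' <;> simp [h, h'] <;> linarith
  · rcases le_total t l with h | h
    · simp only [h, min_eq_left]
      refine ⟨hγG t ⟨ht, h⟩, le_trans ?_ (hJ t ⟨ht, h⟩)⟩
      rw [Real.rpow_one]
      exact div_le_div_of_nonneg_left ht hc (le_max_left _ _)
    · simp only [h, min_eq_right, h1]
      refine ⟨hx₀, ?_⟩
      rw [← hd, div_le_iff₀ (lt_max_of_lt_left hc)]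
      calc t ≤ c := htc
        _ = d * (c / d) := by field_simp
        _ ≤ _ := by gcongr; exact le_max_right _ _

end Geometry

/-- The `p`-th root of the inner integral of the local fractional energy. -/
noncomputable def localFractionalGradient {n : ℕ} (G : Set (EuclideanSpace ℝ (Fin n)))
    (p δ τ : ℝ) (v : EuclideanSpace ℝ (Fin n) → ℝ) : EuclideanSpace ℝ (Fin n) → ℝ≥0∞ :=
  G.indicator fun x => (∫⁻ y in G ∩ ball x (τ * infDist x (frontier G)),
    ‖v x - v y‖ₑ ^ p / ‖x - y‖ₑ ^ ((n : ℝ) + δ * p)) ^ (1 / p)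

/-! ### The local fractional gradient. -/

section Gradient

variable {n : ℕ} {G : Set (EuclideanSpace ℝ (Fin n))} {p δ τ : ℝ}
  {v : EuclideanSpace ℝ (Fin n) → ℝ}

theorem measurable_localFractionalGradient (hG : IsOpen G) (hv : Measurable v) :
    Measurable (localFractionalGradient G p δ τ v) := by
  refine Measurable.indicator (Measurable.pow_const ?_ _) hG.measurableSet
  have hS : MeasurableSet {z : EuclideanSpace ℝ (Fin n) × EuclideanSpace ℝ (Fin n) |
      z.2 ∈ G ∧ dist z.2 z.1 < τ * infDist z.1 (frontier G)} := by
    refine (measurable_snd hG.measurableSet).inter (measurableSet_lt (measurable_snd.dist measurable_fst) ?_)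
    exact ((continuous_infDist_pt _).measurable.comp measurable_fst).const_mul τ
  have hF : Measurable fun z : EuclideanSpace ℝ (Fin n) × EuclideanSpace ℝ (Fin n) =>
      ‖v z.1 - v z.2‖ₑ ^ p / ‖z.1 - z.2‖ₑ ^ ((n : ℝ) + δ * p) := by fun_prop
  have heq (x : EuclideanSpace ℝ (Fin n)) : ∫⁻ y in G ∩ ball x (τ * infDist x (frontier G)),
      ‖v x - v y‖ₑ ^ p / ‖x - y‖ₑ ^ ((n : ℝ) + δ * p) =
      ∫⁻ y, {z : EuclideanSpace ℝ (Fin n) × EuclideanSpace ℝ (Fin n) |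
          z.2 ∈ G ∧ dist z.2 z.1 < τ * infDist z.1 (frontier G)}.indicator
        (fun z => ‖v z.1 - v z.2‖ₑ ^ p / ‖z.1 - z.2‖ₑ ^ ((n : ℝ) + δ * p)) (x, y) := by
    rw [← lintegral_indicator (hG.inter isOpen_ball).measurableSet]
    rfl
  simp_rw [heq]
  exact (hF.indicator hS).lintegral_prod_right'

theorem lintegral_localFractionalGradient_rpow (hG : IsOpen G) (hp : 0 < p) :
    ∫⁻ x, localFractionalGradient G p δ τ v x ^ p = localFractionalEnergy G p δ τ v := by
  rw [localFractionalEnergy, ← lintegral_indicator hG.measurableSet]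
  refine lintegral_congr fun x => ?_
  by_cases hx : x ∈ G
  · simp only [localFractionalGradient, hx, Set.indicator_of_mem]
    rw [← ENNReal.rpow_mul, one_div_mul_cancel hp.ne', ENNReal.rpow_one]
  · simp [localFractionalGradient, hx, hp]

/-- Permits passing to a Borel representative of u. -/
theorem localFractionalEnergy_congr {w : EuclideanSpace ℝ (Fin n) → ℝ}
    (h : v =ᵐ[volume.restrict G] w) :
    localFractionalEnergy G p δ τ v = localFractionalEnergy G p δ τ w := by
  refine lintegral_congr_ae (h.mono fun x hx => lintegral_congr_ae ?_)
  filter_upwards [ae_mono (Measure.restrict_mono Set.inter_subset_left le_rfl) h] with y hy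
  rw [hx, hy]

end Gradient

/-! ### Chains of balls and the pointwise estimate. -/

section Pointwise

variable {n : ℕ} {G : Set (EuclideanSpace ℝ (Fin n))}

/-- The volume of the unit ball as a real number. -/
noncomputable def unitBallVolume (n : ℕ) : ℝ :=
  (volume (ball (0 : EuclideanSpace ℝ (Fin n)) 1)).toReal

theorem unitBallVolume_pos (n : ℕ) : 0 < unitBallVolume n :=
  ENNReal.toReal_pos (measure_ball_pos _ _ one_pos).ne' measure_ball_lt_top.ne

theorem volume_closedBall_eq_ofReal (x : EuclideanSpace ℝ (Fin n)) {r : ℝ} (hr : 0 ≤ r) :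
    volume (closedBall x r) = ENNReal.ofReal (r ^ n * unitBallVolume n) := by
  rw [Measure.addHaar_closedBall _ _ hr, finrank_euclideanSpace_fin,
    ENNReal.ofReal_mul (by positivity), unitBallVolume, ENNReal.ofReal_toReal measure_ball_lt_top.ne]

/-- One step of a chain of balls: the difference of consecutive averages. -/
theorem chain_step_le {p δ τ ε θ : ℝ} (hp : 1 < p) (hδ : 0 < δ) (hε : 0 < ε) (hθ : 0 < θ)
    (hθ1 : θ < 1) (hG : IsOpen G) :
    ∃ K : ℝ≥0, ∀ (v : EuclideanSpace ℝ (Fin n) → ℝ), Measurable v → Integrable v →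
      ∀ (x z w : EuclideanSpace ℝ (Fin n)) (t R : ℝ), 0 < t → 2 * t ≤ R →
        closedBall z (ε * t) ⊆ G → closedBall w (ε * (θ * t)) ⊆ G →
        (∀ a ∈ closedBall z (ε * t), ∀ b ∈ closedBall w (ε * (θ * t)),
          dist a b ≤ 3 * ε * t ∧ dist a b < τ * infDist a (frontier G)) →
        closedBall z (ε * t) ⊆ closedBall x (2 * t) →
        ‖(⨍ y in closedBall z (ε * t), v y) - ⨍ y in closedBall w (ε * (θ * t)), v y‖ₑ ≤
          K * min (ENNReal.ofReal (t ^ δ) *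
              maximalFunction volume R (localFractionalGradient G p δ τ v) x)
            (ENNReal.ofReal (t ^ (-(n / p - δ))) * localFractionalEnergy G p δ τ v ^ (1 / p)) := by
  have hp0 : 0 < p := by linarith
  have hω := unitBallVolume_pos n
  set ω := unitBallVolume n with hωdef
  -- K₁ t^δ is the factor from comparing the two averages, K₂ the volume ratio of the balls of radii
  -- 2t and εt, and K₃ t^(-n/p) the power -1/p of the volume of the ball of radius εt.
  set K₁ : ℝ := ((3 * ε) ^ ((n : ℝ) + δ * p) / ((ε * θ) ^ n * ω)) ^ (1 / p) with hK₁
  set K₂ : ℝ := (2 / ε) ^ n with hK₂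
  set K₃ : ℝ := (ε ^ n * ω) ^ (-(1 / p)) with hK₃
  have hK₁0 : 0 < K₁ := by positivity
  have hK₂0 : 0 < K₂ := by positivity
  have hK₃0 : 0 < K₃ := by positivity
  refine ⟨Real.toNNReal (K₁ * max K₂ K₃), fun v hv hvi x z w t R ht hR hz hw hab hzx => ?_⟩
  set g := localFractionalGradient G p δ τ v with hg
  have hgm : Measurable g := measurable_localFractionalGradient hG hv
  have hεt : 0 < ε * t := by positivity
  have hεθt : 0 < ε * (θ * t) := by positivity
  have hA0 := (measure_closedBall_pos volume z hεt).ne'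
  have hA : volume (closedBall z (ε * t)) ≠ ∞ := measure_closedBall_lt_top.ne
  have hC0 := (measure_closedBall_pos volume x (r := 2 * t) (by positivity)).ne'
  have hC : volume (closedBall x (2 * t)) ≠ ∞ := measure_closedBall_lt_top.ne
  have step := enorm_setAverage_sub_setAverage_le hA0 hA
    (measure_closedBall_pos volume w hεθt).ne' measure_closedBall_lt_top.ne
    measurableSet_closedBall measurableSet_closedBall hv hvi.integrableOn hvi.integrableOn hp
    (s := (n : ℝ) + δ * p) (by positivity) (r := ENNReal.ofReal (3 * ε * t)) ENNReal.ofReal_ne_top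
    (fun a => G ∩ ball a (τ * infDist a (frontier G)))
    (fun a ha b hb => ⟨hw hb, by rw [mem_ball']; exact (hab a ha b hb).2⟩)
    (fun a ha b hb => by
      rw [← edist_eq_enorm_sub, edist_dist]
      exact ENNReal.ofReal_le_ofReal (hab a ha b hb).1)
  have hcoef : (ENNReal.ofReal (3 * ε * t) ^ ((n : ℝ) + δ * p) /
      volume (closedBall w (ε * (θ * t)))) ^ (1 / p) = ENNReal.ofReal (K₁ * t ^ δ) := by
    rw [volume_closedBall_eq_ofReal _ hεθt.le, ENNReal.ofReal_rpow_of_pos (by positivity),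
      ← ENNReal.ofReal_div_of_pos (by positivity), ENNReal.ofReal_rpow_of_pos (by positivity)]
    congr 1
    have e : (3 * ε * t) ^ ((n : ℝ) + δ * p) / ((ε * (θ * t)) ^ n * ω) =
        (3 * ε) ^ ((n : ℝ) + δ * p) / ((ε * θ) ^ n * ω) * t ^ (δ * p) := by
      rw [Real.mul_rpow (by positivity) ht.le, Real.rpow_add ht, Real.rpow_natCast,
        show ε * (θ * t) = ε * θ * t by ring, mul_pow (ε * θ)]
      field_simp
    rw [← hωdef, e, Real.mul_rpow (by positivity) (by positivity), ← Real.rpow_mul ht.le,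
      mul_assoc δ, mul_one_div_cancel hp0.ne', mul_one]
  have hgrad : ⨍⁻ a in closedBall z (ε * t), (∫⁻ b in G ∩ ball a (τ * infDist a (frontier G)),
      ‖v a - v b‖ₑ ^ p / ‖a - b‖ₑ ^ ((n : ℝ) + δ * p)) ^ (1 / p) ∂volume =
      ⨍⁻ a in closedBall z (ε * t), g a ∂volume := by
    rw [setLAverage_eq, setLAverage_eq]
    congr 1
    refine setLIntegral_congr_fun measurableSet_closedBall fun a ha => ?_
    simp only [hg, localFractionalGradient, Set.indicator_of_mem (hz ha)]
  have hb1 : ⨍⁻ a in closedBall z (ε * t), g a ∂volume ≤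
      ENNReal.ofReal K₂ * maximalFunction volume R g x := by
    refine (setLAverage_le_div_mul hzx hC0 hC g).trans (mul_le_mul' (le_of_eq ?_)
      (laverage_le_maximalFunction volume g (by positivity) hR (mem_ball_self (by positivity))))
    rw [volume_closedBall_eq_ofReal _ hεt.le, volume_closedBall_eq_ofReal _ (by positivity),
      ← ENNReal.ofReal_div_of_pos (by positivity)]
    congr 1
    rw [hK₂, ← hωdef, div_pow, mul_pow, mul_pow]
    field_simp
  have hb2 : ⨍⁻ a in closedBall z (ε * t), g a ∂volume ≤
      ENNReal.ofReal (K₃ * t ^ (-(n / p))) * localFractionalEnergy G p δ τ v ^ (1 / p) := by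
    have h1 : (⨍⁻ a in closedBall z (ε * t), g a ∂volume) ^ p ≤
        (volume (closedBall z (ε * t)))⁻¹ * localFractionalEnergy G p δ τ v := by
      refine (setLAverage_rpow_le hA0 hA hp hgm).trans ?_
      rw [setLAverage_eq, div_eq_mul_inv, mul_comm, ← lintegral_localFractionalGradient_rpow hG hp0]
      gcongr
      exact Measure.restrict_le_self
    have h2 := ENNReal.rpow_le_rpow h1 (z := 1 / p) (by positivity)
    rw [← ENNReal.rpow_mul, mul_one_div_cancel hp0.ne', ENNReal.rpow_one,
      ENNReal.mul_rpow_of_nonneg _ _ (by positivity)] at h2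
    refine h2.trans (le_of_eq ?_)
    congr 1
    rw [volume_closedBall_eq_ofReal _ hεt.le, ← ENNReal.ofReal_inv_of_pos (by positivity),
      ENNReal.ofReal_rpow_of_pos (by positivity)]
    congr 1
    rw [hK₃, ← hωdef, Real.inv_rpow (by positivity), ← Real.rpow_neg (by positivity), mul_pow,
      mul_right_comm, Real.mul_rpow (by positivity) (by positivity), ← Real.rpow_natCast t n,
      ← Real.rpow_mul ht.le]
    congr 2
    ring
  rw [hcoef, hgrad] at step
  have hmax1 : K₁ * K₂ ≤ K₁ * max K₂ K₃ := by gcongr; exact le_max_left _ _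
  have hmax2 : K₁ * K₃ ≤ K₁ * max K₂ K₃ := by gcongr; exact le_max_right _ _
  refine step.trans ?_
  rcases le_total (ENNReal.ofReal (t ^ δ) * maximalFunction volume R g x)
    (ENNReal.ofReal (t ^ (-(n / p - δ))) * localFractionalEnergy G p δ τ v ^ (1 / p)) with h | h
  · rw [min_eq_left h]
    calc _ ≤ ENNReal.ofReal (K₁ * t ^ δ) * (ENNReal.ofReal K₂ * maximalFunction volume R g x) := by
          gcongr
      _ = ENNReal.ofReal (K₁ * K₂) * (ENNReal.ofReal (t ^ δ) * maximalFunction volume R g x) := by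
          rw [ENNReal.ofReal_mul hK₁0.le, ENNReal.ofReal_mul hK₁0.le]; ring
      _ ≤ _ := by gcongr; exact ENNReal.ofReal_le_ofReal hmax1
  · rw [min_eq_right h]
    calc _ ≤ ENNReal.ofReal (K₁ * t ^ δ) * (ENNReal.ofReal (K₃ * t ^ (-(n / p))) *
          localFractionalEnergy G p δ τ v ^ (1 / p)) := by gcongr
      _ = ENNReal.ofReal (K₁ * K₃) * (ENNReal.ofReal (t ^ (-(n / p - δ))) *
          localFractionalEnergy G p δ τ v ^ (1 / p)) := by
          rw [show -((n : ℝ) / p - δ) = δ + -(n / p) by ring, Real.rpow_add ht,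
            ENNReal.ofReal_mul hK₁0.le, ENNReal.ofReal_mul hK₁0.le, ENNReal.ofReal_mul hK₃0.le,
            ENNReal.ofReal_mul (Real.rpow_nonneg ht.le _)]
          ring
      _ ≤ _ := by gcongr; exact ENNReal.ofReal_le_ofReal hmax2

/-- The pointwise estimate of Hedberg type on a John domain. -/
theorem IsJohnDomain.exists_ae_enorm_sub_le (hn : 2 ≤ n) (hG : IsJohnDomain 1 G) {p δ τ : ℝ}
    (hτ : τ ∈ Set.Ioo (0 : ℝ) 1) (hδ : 0 < δ) (hpδ : δ < n / p) (hp : 1 < p) :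
    ∃ (B : Set (EuclideanSpace ℝ (Fin n))) (R : ℝ) (C : ℝ≥0),
      ∀ v : EuclideanSpace ℝ (Fin n) → ℝ, Measurable v → Integrable v →
        ∀ᵐ x, x ∈ G → ‖v x - ⨍ y in B, v y‖ₑ ≤
          C * (maximalFunction volume R (localFractionalGradient G p δ τ v) x ^
              ((n / p - δ) / (n / p)) *
            (localFractionalEnergy G p δ τ v ^ (1 / p)) ^ (δ / (n / p))) := by
  obtain ⟨x₀, hx₀, c, hc, L, hL, H⟩ := hG.exists_lipschitz_curve hn
  have hτ0 := hτ.1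
  -- With cε ≤ τ/8 one has 3cε < τ(1 - cε), which keeps consecutive balls within the local balls.
  -- The ratio θ = 1 - ε makes consecutive centres at most εt apart.
  set ε : ℝ := min (τ / (8 * c)) (1 / 2) with hεdef
  have hε : 0 < ε := by positivity
  have hε1 : ε ≤ 1 / 2 := min_le_right _ _
  have hεc : ε * (8 * c) ≤ τ := by
    rw [← le_div_iff₀ (by positivity)]; exact min_le_left _ _
  set θ : ℝ := 1 - ε with hθdef
  have hθ : 0 < θ := by linarith
  have hθ1 : θ < 1 := by linarith
  have hGo := hG.2.1.isOpen
  obtain ⟨K, hK⟩ := chain_step_le (n := n) (G := G) (τ := τ) hp hδ hε hθ hθ1 hGo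
  obtain ⟨C, hC⟩ := tsum_min_mul_le hL hθ hθ1 hδ (sub_pos.2 hpδ)
  refine ⟨closedBall x₀ (ε * L), 2 * L, K * C, fun v hv hvi => ?_⟩
  -- The balls need not contain x, but their 1/ε-enlargements do, since |x - γ(t)| ≤ t. This
  -- suffices for Lebesgue differentiation.
  filter_upwards [IsUnifLocDoublingMeasure.ae_tendsto_average (μ := volume)
    hvi.locallyIntegrable (1 / ε)] with x hx hxG
  obtain ⟨γ, h0, h1, hlip, hJ⟩ := H x hxG
  have ht0 (k : ℕ) : 0 < L * θ ^ k := by positivity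
  have htL (k : ℕ) : L * θ ^ k ≤ L := mul_le_of_le_one_right hL.le (pow_le_one₀ hθ.le hθ1.le)
  have hts (k : ℕ) : L * θ ^ (k + 1) = θ * (L * θ ^ k) := by ring
  have hdist (k : ℕ) : dist x (γ (L * θ ^ k)) ≤ L * θ ^ k := by
    simpa [h0] using hlip 0 _ le_rfl (ht0 k).le (htL k)
  have hinf (k : ℕ) : L * θ ^ k ≤ c * infDist (γ (L * θ ^ k)) (frontier G) := by
    have := (hJ _ (ht0 k).le (htL k)).2
    rwa [div_le_iff₀' hc] at this
  have hsub (k : ℕ) : closedBall (γ (L * θ ^ k)) (ε * (L * θ ^ k)) ⊆ G := by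
    refine closedBall_subset_of_lt_infDist_frontier hGo (hJ _ (ht0 k).le (htL k)).1
      (by have := ht0 k; positivity) ?_
    have h2 := hinf k
    have h3 := ht0 k
    refine lt_of_mul_lt_mul_left (lt_of_lt_of_le ?_ h2) hc.le
    have h4 : c * ε < 1 := by linarith [hτ.2, mul_pos hc hε]
    nlinarith
  have htend : Filter.Tendsto
      (fun k : ℕ => ⨍ y in closedBall (γ (L * θ ^ k)) (ε * (L * θ ^ k)), v y) Filter.atTop
      (nhds (v x)) := by
    refine hx (fun k : ℕ => γ (L * θ ^ k)) (fun k => ε * (L * θ ^ k)) ?_ ?_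
    · refine tendsto_nhdsWithin_iff.2 ⟨?_, Filter.Eventually.of_forall fun k => ?_⟩
      · simpa using ((tendsto_pow_atTop_nhds_zero_of_lt_one hθ.le hθ1).const_mul L).const_mul ε
      · exact mul_pos hε (ht0 k)
    · refine Filter.Eventually.of_forall fun k => ?_
      rw [mem_closedBall, ← mul_assoc, one_div_mul_cancel hε.ne', one_mul]
      exact hdist k
  have hstep (k : ℕ) := hK v hv hvi x (γ (L * θ ^ k)) (γ (L * θ ^ (k + 1))) (L * θ ^ k) (2 * L)
    (ht0 k) (by linarith [htL k]) (hsub k) (by rw [← hts]; exact hsub (k + 1))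
    (fun a ha b hb => by
      rw [mem_closedBall] at ha
      rw [mem_closedBall'] at hb
      have h2 := hlip (L * θ ^ (k + 1)) (L * θ ^ k) (ht0 _).le
        (by rw [hts]; nlinarith [ht0 k]) (htL k)
      rw [dist_comm] at h2
      have h3 := dist_triangle4 a (γ (L * θ ^ k)) (γ (L * θ ^ (k + 1))) b
      have h4 : infDist (γ (L * θ ^ k)) (frontier G) ≤
          infDist a (frontier G) + dist (γ (L * θ ^ k)) a := infDist_le_infDist_add_dist
      rw [dist_comm] at h4
      have h5 := hinf k
      have ht := ht0 k
      have h6 : L * θ ^ (k + 1) = L * θ ^ k - ε * (L * θ ^ k) := by rw [hts, hθdef]; ring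
      replace h2 : dist (γ (L * θ ^ k)) (γ (L * θ ^ (k + 1))) ≤ ε * (L * θ ^ k) :=
        h2.trans (le_of_eq (by rw [h6]; ring))
      clear h6
      generalize L * θ ^ k = t at *
      have h7 : ε * (θ * t) ≤ ε * t := by
        gcongr
        nlinarith
      have h8 : dist a b ≤ 3 * ε * t := by linarith
      refine ⟨h8, h8.trans_lt ?_⟩
      -- The John condition at the centre passes to a, losing at most the radius εt.
      have h9 : (1 - c * ε) * t ≤ c * infDist a (frontier G) := by nlinarith
      have h10 : 3 * c * ε < τ * (1 - c * ε) := by nlinarith [hτ.2, mul_pos hc hε]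
      refine lt_of_mul_lt_mul_left (a := c) ?_ hc.le
      calc c * (3 * ε * t) = 3 * c * ε * t := by ring
        _ < τ * (1 - c * ε) * t := by gcongr
        _ ≤ τ * (c * infDist a (frontier G)) := by rw [mul_assoc]; gcongr
        _ = _ := by ring)
    (closedBall_subset_closedBall' (by
      rw [dist_comm]
      nlinarith [hdist k, ht0 k]))
  -- Telescoping from k = 0, where the ball is centred at γ(L) = x₀ and so does not depend on x, to
  -- the limit v(x).
  have hsum := edist_le_tsum_of_edist_le_of_tendsto₀ (fun k => K *
      min (ENNReal.ofReal ((L * θ ^ k) ^ δ) *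
        maximalFunction volume (2 * L) (localFractionalGradient G p δ τ v) x)
      (ENNReal.ofReal ((L * θ ^ k) ^ (-(n / p - δ))) *
        localFractionalEnergy G p δ τ v ^ (1 / p))) (fun k => by
    have h := hstep k
    rw [← hts k] at h
    rwa [edist_eq_enorm_sub]) htend
  simp only [pow_zero, mul_one, h1] at hsum
  rw [edist_comm, edist_eq_enorm_sub] at hsum
  refine hsum.trans ?_
  rw [ENNReal.tsum_mul_left, ENNReal.coe_mul, mul_assoc]
  gcongr
  have := hC (maximalFunction volume (2 * L) (localFractionalGradient G p δ τ v) x)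
    (localFractionalEnergy G p δ τ v ^ (1 / p))
  rwa [add_sub_cancel] at this

end Pointwise

/-! ### Integration and the passage to the exponent q and the mean over G. -/

/-- Hölder's inequality against the constant 1; it lowers the critical exponent to q. -/
theorem lintegral_enorm_rpow_le_of_le {α : Type*} [MeasurableSpace α] {μ : Measure α} {q r : ℝ}
    (hq : 0 < q) (hqr : q ≤ r) {f : α → ℝ} (hf : AEStronglyMeasurable f μ) :
    ∫⁻ x, ‖f x‖ₑ ^ q ∂μ ≤ (∫⁻ x, ‖f x‖ₑ ^ r ∂μ) ^ (q / r) * μ Set.univ ^ (1 - q / r) := by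
  have h := eLpNorm'_le_eLpNorm'_mul_rpow_measure_univ hq hqr hf
  have h2 := ENNReal.rpow_le_rpow h hq.le
  rw [eLpNorm'_eq_lintegral_enorm, eLpNorm'_eq_lintegral_enorm,
    ENNReal.mul_rpow_of_nonneg _ _ hq.le, ← ENNReal.rpow_mul, ← ENNReal.rpow_mul,
    ← ENNReal.rpow_mul, one_div_mul_cancel hq.ne', ENNReal.rpow_one] at h2
  convert h2 using 3
  · ring
  · field_simp

/-- Replacing an arbitrary constant by the mean costs at most a factor `2 ^ q`. -/
theorem lintegral_enorm_sub_average_rpow_le {α : Type*} [MeasurableSpace α] {μ : Measure α}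
    {s : Set α} (h0 : μ s ≠ 0) (hs : μ s ≠ ∞) {q : ℝ} (hq : 1 < q) {f : α → ℝ} (hf : Measurable f)
    (hfi : IntegrableOn f s μ) (c : ℝ) :
    ∫⁻ x in s, ‖f x - ⨍ y in s, f y ∂μ‖ₑ ^ q ∂μ ≤ 2 ^ q * ∫⁻ x in s, ‖f x - c‖ₑ ^ q ∂μ := by
  have hq0 : 0 < q := by linarith
  have hmean : ‖(⨍ y in s, f y ∂μ) - c‖ₑ ^ q * μ s ≤ ∫⁻ x in s, ‖f x - c‖ₑ ^ q ∂μ := by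
    have h := (ENNReal.rpow_le_rpow (enorm_setAverage_sub_le h0 hs hfi c) hq0.le).trans
      (setLAverage_rpow_le h0 hs hq (hf.sub_const c).enorm)
    rwa [setLAverage_eq, ENNReal.le_div_iff_mul_le (.inl h0) (.inl hs)] at h
  calc ∫⁻ x in s, ‖f x - ⨍ y in s, f y ∂μ‖ₑ ^ q ∂μ
      ≤ ∫⁻ x in s, 2 ^ (q - 1) * (‖f x - c‖ₑ ^ q + ‖(⨍ y in s, f y ∂μ) - c‖ₑ ^ q) ∂μ := by
        refine lintegral_mono fun x => ?_
        refine le_trans (ENNReal.rpow_le_rpow ?_ hq0.le)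
          (ENNReal.rpow_add_le_mul_rpow_add_rpow _ _ hq.le)
        calc ‖f x - ⨍ y in s, f y ∂μ‖ₑ = ‖(f x - c) - ((⨍ y in s, f y ∂μ) - c)‖ₑ := by
              rw [sub_sub_sub_cancel_right]
          _ ≤ _ := enorm_sub_le
    _ = 2 ^ (q - 1) * ((∫⁻ x in s, ‖f x - c‖ₑ ^ q ∂μ) +
          ‖(⨍ y in s, f y ∂μ) - c‖ₑ ^ q * μ s) := by
        rw [lintegral_const_mul' _ _ (ENNReal.rpow_ne_top_of_nonneg (by linarith) (by simp)),
          lintegral_add_right _ measurable_const, setLIntegral_const]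
    _ ≤ 2 ^ (q - 1) * (2 * ∫⁻ x in s, ‖f x - c‖ₑ ^ q ∂μ) := by
        rw [two_mul]; gcongr
    _ = _ := by
        rw [← mul_assoc]
        congr 1
        conv_lhs => rw [← ENNReal.rpow_one 2, ← ENNReal.rpow_mul, one_mul]
        rw [← ENNReal.rpow_add _ _ (by simp) (by simp), sub_add_cancel]

/-- The inequality at the critical exponent, for the distance to a suitable constant. -/
theorem IsJohnDomain.exists_lintegral_enorm_sub_rpow_le {n : ℕ} (hn : 2 ≤ n)
    {G : Set (EuclideanSpace ℝ (Fin n))} (hG : IsJohnDomain 1 G) {p δ τ : ℝ}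
    (hτ : τ ∈ Set.Ioo (0 : ℝ) 1) (hδ : 0 < δ) (hpδ : δ * p < n) (hp : 1 < p) :
    ∃ (B : Set (EuclideanSpace ℝ (Fin n))) (C : ℝ≥0),
      ∀ v : EuclideanSpace ℝ (Fin n) → ℝ, Measurable v → Integrable v →
        ∫⁻ x in G, ‖v x - ⨍ y in B, v y‖ₑ ^ (n * p / (n - δ * p)) ≤
          C * localFractionalEnergy G p δ τ v ^ (n * p / (n - δ * p) / p) := by
  have hp0 : 0 < p := by linarith
  have hn0 : (0 : ℝ) < n := by positivity
  have hnd : 0 < n - δ * p := by linarith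
  obtain ⟨B, R, C, hC⟩ := hG.exists_ae_enorm_sub_le hn hτ hδ ((lt_div_iff₀ hp0).2 hpδ) hp
  obtain ⟨C', hC'⟩ := lintegral_maximalFunction_rpow_le
    (volume : Measure (EuclideanSpace ℝ (Fin n))) hp
  set r : ℝ := n * p / (n - δ * p) with hr
  have hr0 : 0 < r := by positivity
  -- The critical exponent r is the one that turns Hedberg's power of the maximal function into p;
  -- the remaining energy power r/p - 1 rises to r/p once the maximal inequality supplies one more
  -- factor.
  have e1 : (n / p - δ) / (n / p) * r = p := by
    rw [hr, show n / p - δ = (n - δ * p) / p by field_simp]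
    generalize (n : ℝ) - δ * p = d at hnd
    field_simp
  have e2 : 1 / p * (δ / (n / p)) * r = r / p - 1 := by
    rw [hr]
    obtain ⟨d, hd⟩ : ∃ d, d = n - δ * p := ⟨_, rfl⟩
    rw [← hd] at hnd ⊢
    field_simp
    linarith
  have e3 : 0 ≤ r / p - 1 := by rw [← e2]; positivity
  refine ⟨B, C ^ r * C', fun v hv hvi => ?_⟩
  set g := localFractionalGradient G p δ τ v with hg
  set e := localFractionalEnergy G p δ τ v with he
  have hgm : Measurable g := measurable_localFractionalGradient hG.2.1.isOpen hv
  calc ∫⁻ x in G, ‖v x - ⨍ y in B, v y‖ₑ ^ r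
      ≤ ∫⁻ x in G, C ^ r * e ^ (r / p - 1) * maximalFunction volume R g x ^ p := by
        refine lintegral_mono_ae ?_
        filter_upwards [(ae_restrict_iff' hG.2.1.isOpen.measurableSet).2 (hC v hv hvi)] with x hx
        refine (ENNReal.rpow_le_rpow hx hr0.le).trans (le_of_eq ?_)
        rw [ENNReal.mul_rpow_of_nonneg _ _ hr0.le, ENNReal.mul_rpow_of_nonneg _ _ hr0.le,
          ← ENNReal.rpow_mul, e1, ← ENNReal.rpow_mul, ← ENNReal.rpow_mul, ← mul_assoc (1 / p) _ r, e2]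
        ring
    _ ≤ ∫⁻ x, C ^ r * e ^ (r / p - 1) * maximalFunction volume R g x ^ p :=
        lintegral_mono' Measure.restrict_le_self le_rfl
    _ = C ^ r * e ^ (r / p - 1) * ∫⁻ x, maximalFunction volume R g x ^ p :=
        lintegral_const_mul _ ((measurable_maximalFunction _ _ _).pow_const _)
    _ ≤ C ^ r * e ^ (r / p - 1) * (C' * e) := by
        gcongr
        rw [he, ← lintegral_localFractionalGradient_rpow hG.2.1.isOpen hp0]
        exact hC' R g hgm
    _ = C ^ r * C' * (e ^ (r / p - 1) * e) := by ring
    _ = _ := by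
        rw [ENNReal.coe_mul, ENNReal.coe_rpow_of_nonneg _ hr0.le]
        congr 1
        conv_lhs => rw [← ENNReal.rpow_one e, ← ENNReal.rpow_mul, one_mul]
        rw [← ENNReal.rpow_add_of_nonneg _ _ e3 zero_le_one, sub_add_cancel]

theorem theorem4p6 (n : ℕ) (hn : 2 ≤ n) (G : Set (EuclideanSpace ℝ (Fin n)))
    (hG : IsJohnDomain 1 G) (p q δ τ : ℝ) (hτ : τ ∈ Set.Ioo (0 : ℝ) 1)
    (hδ : δ ∈ Set.Ioo (0 : ℝ) 1) (hpδ : p < n / δ) (hp : 1 < p) (hpq : p ≤ q)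
    (hq : q ≤ n * p / (n - δ * p)) :
    SupportsFractionalPoincare G q p δ τ := by
  have hp0 : 0 < p := by linarith
  have hq0 : 0 < q := by linarith
  have hpδ' : δ * p < n := by rwa [lt_div_iff₀' hδ.1] at hpδ
  obtain ⟨B, C, hC⟩ := hG.exists_lintegral_enorm_sub_rpow_le hn hτ hδ.1 hpδ' hp
  set r : ℝ := n * p / (n - δ * p) with hr
  have hr0 : 0 < r := hq0.trans_le hq
  have hGo : IsOpen G := hG.2.1.isOpen
  have hGm : MeasurableSet G := hGo.measurableSet
  have hG0 : volume G ≠ 0 := (hGo.measure_pos volume hG.2.1.isConnected.nonempty).ne'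
  have hGfin : volume G ≠ ∞ := hG.2.1.isBounded.measure_lt_top.ne
  let K : ℝ≥0∞ := 2 ^ q * (C ^ (q / r) * volume G ^ (1 - q / r))
  have hqr : q / r ≤ 1 := (div_le_one hr0).2 hq
  have hqr0 : 0 ≤ q / r := by positivity
  have hK : K ≠ ∞ := by
    refine ENNReal.mul_ne_top (ENNReal.rpow_ne_top_of_nonneg hq0.le (by simp)) (ENNReal.mul_ne_top
      (ENNReal.rpow_ne_top_of_nonneg hqr0 (by simp))
      (ENNReal.rpow_ne_top_of_nonneg (by linarith) hGfin))
  refine ⟨K.toNNReal, fun u hu => ?_⟩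
  rw [ENNReal.coe_toNNReal hK]
  have : IsFiniteMeasure (volume.restrict G) := ⟨by simpa using hGfin.lt_top⟩
  -- A Borel representative, cut off outside G so as to be integrable on the whole space; both sides
  -- only see values in G up to null sets.
  let v : EuclideanSpace ℝ (Fin n) → ℝ := G.indicator (hu.1.mk u)
  have hv : Measurable v := hu.1.stronglyMeasurable_mk.measurable.indicator hGm
  have huv : u =ᵐ[volume.restrict G] v := by
    filter_upwards [hu.1.ae_eq_mk, ae_restrict_mem hGm] with x hx hxG
    simp only [v, Set.indicator_of_mem hxG, hx]
  have hui : Integrable u (volume.restrict G) :=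
    hu.integrable (by rw [ENNReal.one_le_ofReal]; exact hp.le)
  have hvi : Integrable v :=
    (integrable_indicator_iff hGm).2 (hui.congr hu.1.ae_eq_mk)
  have hlhs : ∫⁻ x in G, ‖u x - ⨍ y in G, u y‖ₑ ^ q = ∫⁻ x in G, ‖v x - ⨍ y in G, v y‖ₑ ^ q := by
    rw [average_congr huv]
    exact lintegral_congr_ae (huv.mono fun x hx => by simp only [hx])
  rw [hlhs, localFractionalEnergy_congr huv]
  calc ∫⁻ x in G, ‖v x - ⨍ y in G, v y‖ₑ ^ q
      ≤ 2 ^ q * ∫⁻ x in G, ‖v x - ⨍ y in B, v y‖ₑ ^ q :=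
        lintegral_enorm_sub_average_rpow_le hG0 hGfin (by linarith) hv hvi.integrableOn _
    _ ≤ 2 ^ q * ((∫⁻ x in G, ‖v x - ⨍ y in B, v y‖ₑ ^ r) ^ (q / r) *
          volume.restrict G Set.univ ^ (1 - q / r)) := by
        gcongr
        exact lintegral_enorm_rpow_le_of_le hq0 hq (hv.sub_const _).aestronglyMeasurable
    _ ≤ 2 ^ q * ((C * localFractionalEnergy G p δ τ v ^ (r / p)) ^ (q / r) *
          volume G ^ (1 - q / r)) := by
        rw [Measure.restrict_apply_univ]
        gcongr
        exact hC v hv hvi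
    _ = K * localFractionalEnergy G p δ τ v ^ (q / p) := by
        rw [ENNReal.mul_rpow_of_nonneg _ _ hqr0, ← ENNReal.rpow_mul,
          show r / p * (q / r) = q / p by field_simp]
        simp only [K]
        ring
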